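/- Let $K$ be a commutative ring. All algebras are unital associative $K$-algebras. An algebra extension $A\,|\,B$ is a $K$-algebra homomorphism $\varphi\colon B\to A$ (not necessarily injective); it makes $A$ a $B$-$B$-bimodule, and $A\otimes_B A$ a $B$-$A$-bimodule and an $A$-$B$-bimodule in the natural way. The extension $A\,|\,B$ is - *left depth two* if $A\otimes_B A\oplus Q\cong A^n$ as $B$-$A$-bimodules for some integer $n\ge 0$ and some $B$-$A$-bimodule $Q$; - *right depth two* if $A\otimes_B A\oplus Q\cong A^n$ as $A$-$B$-bimodules for some integer $n\ge 0$ and some $A$-$B$-bimodule $Q$; - *depth two* if it is both left and right depth two; - *left balanced* if the natural left module ${}_BA$ is balanced: with $E=\operatorname{End}({}_BA)$ acting on $A$ by evaluation, the map from $B$ to the ring of $E$-linear endomorphisms of $A$, $b\mapsto(x\mapsto \varphi(b)x)$, is bijective. **Corollary 2.3 (endomorphism ring theorem).** Let $A\,|\,B$ be a depth two algebra extension. Let $\operatorname{End}({}_BA)$ be the algebra of left $B$-linear endomorphisms of $A$ under composition, viewed as an extension of the opposite algebra $A^{\mathrm{op}}$ through the algebra homomorphism $\rho\colon A^{\mathrm{op}}\to\operatorname{End}({}_BA)$,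 $\rho(a)(x)=xa$. Then $\operatorname{End}({}_BA)\,|\,A^{\mathrm{op}}$ is left depth two and left balanced. -/

import Mathlib

open scoped TensorProduct

section DepthTwo

universe w u v

variable {K : Type w} [CommRing K] {A : Type u} [Ring A] [Algebra K A]
  {B : Type v} [Ring B] [Algebra K B]

/-- An algebra extension `A | B` is an algebra homomorphism `φ : B → A` (not necessarily
injective). These are the relations `(a b) ⊗ a' = a ⊗ (b a')` that cut `A ⊗_B A` out of
`A ⊗_K A`; as `K` acts through `B`, this is the same quotient as that of `A ⊗_ℤ A`. -/
def balancingRelations (φ : B →ₐ[K] A) : Submodule K (A ⊗[K] A) :=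
  Submodule.span K {t | ∃ (a : A) (b : B) (a' : A),
    t = (a * φ b) ⊗ₜ[K] a' - a ⊗ₜ[K] (φ b * a')}

/-- The tensor-square `A ⊗_B A` of the extension `φ : B → A`, with `B` noncommutative. -/
abbrev TensorSquare (φ : B →ₐ[K] A) : Type u :=
  (A ⊗[K] A) ⧸ balancingRelations φ

/-- The pure tensor `a ⊗_B a'`. -/
def TensorSquare.tmul (φ : B →ₐ[K] A) (a a' : A) : TensorSquare φ :=
  (balancingRelations φ).mkQ (a ⊗ₜ[K] a')

theorem TensorSquare.tmul_balanced (φ : B →ₐ[K] A) (a : A) (b : B) (a' : A) :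
    TensorSquare.tmul φ (a * φ b) a' = TensorSquare.tmul φ a (φ b * a') := by
  refine (Submodule.Quotient.eq _).2 (Submodule.subset_span ⟨a, b, a', rfl⟩)

/-- The natural left `A`-action `c · (a ⊗ a') = (c a) ⊗ a'` on `A ⊗_B A`. -/
def TensorSquare.leftMul (φ : B →ₐ[K] A) (c : A) : TensorSquare φ →ₗ[K] TensorSquare φ :=
  (balancingRelations φ).mapQ (balancingRelations φ)
    (LinearMap.rTensor A (LinearMap.mulLeft K c)) (by
      refine Submodule.span_le.2 ?_
      rintro _ ⟨a, b, a', rfl⟩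
      refine Submodule.subset_span ⟨c * a, b, a', ?_⟩
      simp [mul_assoc])

/-- The natural right `A`-action `(a ⊗ a') · c = a ⊗ (a' c)` on `A ⊗_B A`. -/
def TensorSquare.rightMul (φ : B →ₐ[K] A) (c : A) : TensorSquare φ →ₗ[K] TensorSquare φ :=
  (balancingRelations φ).mapQ (balancingRelations φ)
    (LinearMap.lTensor A (LinearMap.mulRight K c)) (by
      refine Submodule.span_le.2 ?_
      rintro _ ⟨a, b, a', rfl⟩
      refine Submodule.subset_span ⟨a, b, a' * c, ?_⟩
      simp [mul_assoc])

theorem TensorSquare.leftMul_tmul (φ : B →ₐ[K] A) (c a a' : A) :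
    TensorSquare.leftMul φ c (TensorSquare.tmul φ a a') = TensorSquare.tmul φ (c * a) a' := rfl

theorem TensorSquare.rightMul_tmul (φ : B →ₐ[K] A) (c a a' : A) :
    TensorSquare.rightMul φ c (TensorSquare.tmul φ a a') = TensorSquare.tmul φ a (a' * c) := rfl

/-- `A | B` is left depth two: `A ⊗_B A ⊕ Q ≅ A ⊕ ⋯ ⊕ A` (`n` copies) as `B`-`A`-bimodules, for
some `n` and some `B`-`A`-bimodule `Q`. (Such a `Q` embeds in `Aⁿ`, so that its size and the
symmetry of its `K`-action are no restriction.) -/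
def IsLeftDepthTwo (φ : B →ₐ[K] A) : Prop :=
  ∃ (n : ℕ) (Q : Type u) (_ : AddCommGroup Q) (_ : Module B Q) (_ : Module Aᵐᵒᵖ Q)
    (_ : SMulCommClass B Aᵐᵒᵖ Q) (e : (TensorSquare φ × Q) ≃+ (Fin n → A)),
    (∀ (b : B) (t : TensorSquare φ) (q : Q) (i : Fin n),
      e (TensorSquare.leftMul φ (φ b) t, b • q) i = φ b * e (t, q) i) ∧
    (∀ (a : A) (t : TensorSquare φ) (q : Q) (i : Fin n),
      e (TensorSquare.rightMul φ a t, MulOpposite.op a • q) i = e (t, q) i * a)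

/-- `A | B` is right depth two: `A ⊗_B A ⊕ Q ≅ A ⊕ ⋯ ⊕ A` (`n` copies) as `A`-`B`-bimodules, for
some `n` and some `A`-`B`-bimodule `Q`. -/
def IsRightDepthTwo (φ : B →ₐ[K] A) : Prop :=
  ∃ (n : ℕ) (Q : Type u) (_ : AddCommGroup Q) (_ : Module A Q) (_ : Module Bᵐᵒᵖ Q)
    (_ : SMulCommClass A Bᵐᵒᵖ Q) (e : (TensorSquare φ × Q) ≃+ (Fin n → A)),
    (∀ (a : A) (t : TensorSquare φ) (q : Q) (i : Fin n),
      e (TensorSquare.leftMul φ a t, a • q) i = a * e (t, q) i) ∧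
    (∀ (b : B) (t : TensorSquare φ) (q : Q) (i : Fin n),
      e (TensorSquare.rightMul φ (φ b) t, MulOpposite.op b • q) i = e (t, q) i * φ b)

/-- `A | B` is depth two: both left and right depth two. -/
def IsDepthTwo (φ : B →ₐ[K] A) : Prop :=
  IsLeftDepthTwo φ ∧ IsRightDepthTwo φ

/-- The algebra `End _B A` of endomorphisms of the natural left `B`-module `A`, under
composition. (Additive left `B`-linear maps are automatically `K`-linear.) -/
def leftEnd (φ : B →ₐ[K] A) : Subalgebra K (Module.End K A) where
  carrier := {f | ∀ (b : B) (x : A), f (φ b * x) = φ b * f x}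
  mul_mem' := by
    intro f g hf hg b x
    simp only [Set.mem_ofPred_eq] at hf hg
    simp [hf, hg]
  add_mem' := by
    intro f g hf hg b x
    simp only [Set.mem_ofPred_eq] at hf hg
    simp [hf, hg, mul_add]
  algebraMap_mem' := by
    intro k b x
    simp

/-- The canonical map `λ : B → End (A_E)`, `λ(b)(x) = b x`, where `E = End _B A` acts on `A` by
evaluation. -/
def lambdaMap (φ : B →ₐ[K] A) (b : B) : Module.End (leftEnd φ) A where
  toFun x := φ b * x
  map_add' := mul_add _
  map_smul' f x := (f.2 b x).symm

/-- `A | B` is left balanced: the natural left module `_B A` is balanced, that is, with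
`E = End _B A`, the canonical map `λ : B → End (A_E)` is bijective. -/
def IsLeftBalanced (φ : B →ₐ[K] A) : Prop :=
  Function.Bijective (lambdaMap φ)

/-- The algebra homomorphism `ρ : A^op → End _B A`, `ρ(a)(x) = x a`. It makes `End _B A` an algebra
extension of `A^op`. -/
def rhoHom (φ : B →ₐ[K] A) : Aᵐᵒᵖ →ₐ[K] leftEnd φ where
  toFun a := ⟨LinearMap.mulRight K a.unop, fun b x => by simp [mul_assoc]⟩
  map_one' := by ext x; simp
  map_mul' a a' := by ext x; simp [mul_assoc]
  map_zero' := by ext x; simp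
  map_add' a a' := by ext x; simp [mul_add]
  commutes' k := by
    ext x
    simp [Algebra.smul_def, Algebra.commutes]

end DepthTwo

/-! Write `E` for `leftEnd φ`. Right depth two amounts to a quasibasis: `B`-bilinear `γ j` and
`B`-central `u j` in `A ⊗_B A` with `∑ γ j y · u j = 1 ⊗ y` (`exists_quasibasis`). It makes the
evaluations `f ⊗ g ↦ f (x * g y)` jointly injective on the tensor square of `E` over `A^op`
(`eq_of_evalAt_eq`), and gives elements `c j` with evaluations `γ j x * y` (`exists_evalAt_eq`). Let
`β j f` send `y` to `u¹ f(u² y)`, where `u = u j`. Then `∑ c j · β j f` evaluates to `∑ γ j x · u¹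
f(u² y) = f (x * y)`, as does `f ⊗ 1`. Thus `β`, `c` form a left quasibasis, and
`isLeftDepthTwo_of_quasibasis` applies. Balance comes from testing commutation against explicit
endomorphisms of `E`. -/

section EndomorphismRing

universe w u v

variable {K : Type w} [CommRing K] {A : Type u} [Ring A] [Algebra K A]
  {B : Type v} [Ring B] [Algebra K B] (φ : B →ₐ[K] A)

/-! ### Universal property and `A`-actions of the tensor square. -/

namespace TensorSquare

/-- Balanced bilinear maps factor through `A ⊗_B A`. -/
def lift {M : Type*} [AddCommGroup M] [Module K M] (F : A →ₗ[K] A →ₗ[K] M)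
    (hF : ∀ a b a', F (a * φ b) a' = F a (φ b * a')) : TensorSquare φ →ₗ[K] M :=
  (balancingRelations φ).liftQ (TensorProduct.lift F) (by
    refine Submodule.span_le.2 ?_
    rintro _ ⟨a, b, a', rfl⟩
    simp [hF])

@[simp]
theorem lift_tmul {M : Type*} [AddCommGroup M] [Module K M] (F : A →ₗ[K] A →ₗ[K] M)
    (hF : ∀ a b a', F (a * φ b) a' = F a (φ b * a')) (a a' : A) :
    lift φ F hF (tmul φ a a') = F a a' := rfl

/-- The pure tensor as a bilinear map. -/
def mk : A →ₗ[K] A →ₗ[K] TensorSquare φ :=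
  (TensorProduct.mk K A A).compr₂ (balancingRelations φ).mkQ

theorem mk_apply (a a' : A) : mk φ a a' = tmul φ a a' := rfl

variable {φ}

@[elab_as_elim]
theorem induction_on {p : TensorSquare φ → Prop} (t : TensorSquare φ)
    (tmul : ∀ a a', p (tmul φ a a')) (add : ∀ s t, p s → p t → p (s + t)) : p t := by
  obtain ⟨t, rfl⟩ := Submodule.mkQ_surjective _ t
  induction t with
  | zero =>
    rw [← TensorProduct.zero_tmul A (0 : A)]
    exact tmul 0 0
  | tmul a a' => exact tmul a a'
  | add s t hs ht =>
    rw [map_add]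
    exact add _ _ hs ht

theorem leftMul_add (c d : A) (t : TensorSquare φ) :
    leftMul φ (c + d) t = leftMul φ c t + leftMul φ d t := by
  induction t using induction_on with
  | tmul a a' =>
    simp only [leftMul_tmul, add_mul]
    simp only [← mk_apply, map_add, LinearMap.add_apply]
  | add s t hs ht => rw [map_add, map_add, map_add, hs, ht]; abel

theorem rightMul_add (c d : A) (t : TensorSquare φ) :
    rightMul φ (c + d) t = rightMul φ c t + rightMul φ d t := by
  induction t using induction_on with
  | tmul a a' =>
    simp only [rightMul_tmul, mul_add]
    simp only [← mk_apply, map_add]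
  | add s t hs ht => rw [map_add, map_add, map_add, hs, ht]; abel

theorem leftMul_smul (k : K) (c : A) (t : TensorSquare φ) :
    leftMul φ (k • c) t = k • leftMul φ c t := by
  induction t using induction_on with
  | tmul a a' =>
    simp only [leftMul_tmul, smul_mul_assoc]
    simp only [← mk_apply, map_smul, LinearMap.smul_apply]
  | add s t hs ht => rw [map_add, map_add, hs, ht, smul_add]

theorem rightMul_smul (k : K) (c : A) (t : TensorSquare φ) :
    rightMul φ (k • c) t = k • rightMul φ c t := by
  induction t using induction_on with
  | tmul a a' =>
    simp only [rightMul_tmul, mul_smul_comm]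
    simp only [← mk_apply, map_smul]
  | add s t hs ht => rw [map_add, map_add, hs, ht, smul_add]

theorem leftMul_mul (c d : A) (t : TensorSquare φ) :
    leftMul φ (c * d) t = leftMul φ c (leftMul φ d t) := by
  induction t using induction_on with
  | tmul a a' => simp only [leftMul_tmul, mul_assoc]
  | add s t hs ht => simp only [map_add, hs, ht]

theorem rightMul_mul (c d : A) (t : TensorSquare φ) :
    rightMul φ (c * d) t = rightMul φ d (rightMul φ c t) := by
  induction t using induction_on with
  | tmul a a' => simp only [rightMul_tmul, mul_assoc]
  | add s t hs ht => simp only [map_add, hs, ht]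

theorem leftMul_rightMul (c d : A) (t : TensorSquare φ) :
    leftMul φ c (rightMul φ d t) = rightMul φ d (leftMul φ c t) := by
  induction t using induction_on with
  | tmul a a' => rfl
  | add s t hs ht => simp only [map_add, hs, ht]

end TensorSquare

/-! ### Depth two in terms of quasibases. -/

open TensorSquare

variable {φ}

theorem IsRightDepthTwo.exists_quasibasis (h : IsRightDepthTwo φ) :
    ∃ (n : ℕ) (γ : Fin n → leftEnd φ) (u : Fin n → TensorSquare φ),
      (∀ j x b, (γ j).1 (x * φ b) = (γ j).1 x * φ b) ∧
      (∀ j b, leftMul φ (φ b) (u j) = rightMul φ (φ b) (u j)) ∧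
      ∀ y, ∑ j, leftMul φ ((γ j).1 y) (u j) = tmul φ 1 y := by
  obtain ⟨n, Q, _, _, _, _, e, hl, hr⟩ := h
  have hγ (j : Fin n) (c y : A) : e (tmul φ c y, 0) j = c * e (tmul φ 1 y, 0) j := by
    simpa [leftMul_tmul] using hl c (tmul φ 1 y) 0 j
  let γ (j : Fin n) : leftEnd φ :=
    ⟨{ toFun := fun y => e (tmul φ 1 y, 0) j
       map_add' := fun y z => by
        rw [← Pi.add_apply, ← map_add, Prod.mk_add_mk, add_zero, ← mk_apply, map_add]
        rfl
       -- `e` is only additive, so `k` is carried across the tensor sign as `φ (algebraMap k)`.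
       map_smul' := fun k y => by
        rw [RingHom.id_apply, Algebra.smul_def, Algebra.smul_def, ← hγ, ← φ.commutes k,
          ← tmul_balanced, one_mul] }, fun b y => by
      change e (tmul φ 1 (φ b * y), 0) j = φ b * e (tmul φ 1 y, 0) j
      rw [← hγ, ← tmul_balanced, one_mul]⟩
  have key (j : Fin n) (a : A) : e (leftMul φ a (e.symm (Pi.single j 1)).1,
      a • (e.symm (Pi.single j 1)).2) = Pi.single j a := by
    funext i
    rw [hl, Prod.mk.eta, e.apply_symm_apply]
    by_cases hij : i = j
    · subst hij; simp
    · simp [hij]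
  refine ⟨n, γ, fun j => (e.symm (Pi.single j 1)).1, fun j x b => ?_, fun j b => ?_, fun y => ?_⟩
  · have := hr b (tmul φ 1 x) 0 j
    rwa [rightMul_tmul, smul_zero] at this
  -- The `j`-th unit vector of `Aⁿ` commutes with `B`, hence so does its preimage.
  · refine congrArg Prod.fst (e.injective (a₁ := (_, φ b • (e.symm (Pi.single j 1)).2))
      (a₂ := (_, MulOpposite.op b • (e.symm (Pi.single j 1)).2)) ?_)
    rw [key]
    funext i
    rw [hr, Prod.mk.eta, e.apply_symm_apply]
    by_cases hij : i = j
    · subst hij; simp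
    · simp [hij]
  · have : (tmul φ 1 y, (0 : Q)) = ∑ j, (leftMul φ ((γ j).1 y) (e.symm (Pi.single j 1)).1,
        (γ j).1 y • (e.symm (Pi.single j 1)).2) := by
      apply e.injective
      simp only [map_sum, key]
      exact (Finset.univ_sum_single _).symm
    simpa [Prod.fst_sum] using (congrArg Prod.fst this).symm

/-- The bimodule map `p : x ↦ ∑ c j · x j` is split by `x ⊗ y ↦ (β j x * y)`, so `p.ker` serves as
the complement `Q`. -/
theorem isLeftDepthTwo_of_quasibasis {n : ℕ} (β : Fin n → A →ₗ[K] A) (c : Fin n → TensorSquare φ)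
    (hβl : ∀ j b x, β j (φ b * x) = φ b * β j x) (hβr : ∀ j x b, β j (x * φ b) = β j x * φ b)
    (hc : ∀ j b, leftMul φ (φ b) (c j) = rightMul φ (φ b) (c j))
    (h : ∀ x, ∑ j, rightMul φ (β j x) (c j) = tmul φ x 1) : IsLeftDepthTwo φ := by
  let α (j : Fin n) : TensorSquare φ →ₗ[K] A :=
    lift φ ((LinearMap.mul K A).comp (β j)) fun a b a' => by simp [hβr, mul_assoc]
  have hl (j : Fin n) (b : B) (t : TensorSquare φ) :
      α j (leftMul φ (φ b) t) = φ b * α j t := by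
    induction t using induction_on with
    | tmul x y =>
      change β j (φ b * x) * y = φ b * (β j x * y)
      rw [hβl, mul_assoc]
    | add s t hs ht => simp only [map_add, hs, ht, mul_add]
  have hr (j : Fin n) (a : A) (t : TensorSquare φ) : α j (rightMul φ a t) = α j t * a := by
    induction t using induction_on with
    | tmul x y => exact (mul_assoc _ _ _).symm
    | add s t hs ht => simp only [map_add, hs, ht, add_mul]
  let p : (Fin n → A) →+ TensorSquare φ :=
    { toFun := fun x => ∑ j, rightMul φ (x j) (c j)
      map_zero' := by
        have h0 (t : TensorSquare φ) : rightMul φ 0 t = 0 := by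
          simpa using rightMul_smul (0 : K) (0 : A) t
        simp [h0]
      map_add' := fun x y => by simp [rightMul_add, Finset.sum_add_distrib] }
  have hpl (b : B) (x : Fin n → A) : p (fun j => φ b * x j) = leftMul φ (φ b) (p x) := by
    change ∑ j, rightMul φ (φ b * x j) (c j) = leftMul φ (φ b) (∑ j, rightMul φ (x j) (c j))
    simp only [map_sum, leftMul_rightMul, hc, rightMul_mul]
  have hpr (a : A) (x : Fin n → A) : p (fun j => x j * a) = rightMul φ a (p x) := by
    change ∑ j, rightMul φ (x j * a) (c j) = rightMul φ a (∑ j, rightMul φ (x j) (c j))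
    simp only [map_sum, rightMul_mul]
  have hpα (t : TensorSquare φ) : p (fun j => α j t) = t := by
    induction t using induction_on with
    | tmul x y =>
      change ∑ j, rightMul φ (β j x * y) (c j) = tmul φ x y
      simp only [rightMul_mul, ← map_sum, h, rightMul_tmul, one_mul]
    | add s t hs ht =>
      conv_rhs => rw [← hs, ← ht, ← map_add]
      exact congrArg p (funext fun j => map_add _ _ _)
  let modB : Module B p.ker :=
    { smul := fun b q => ⟨fun j => φ b * q.1 j, by
        rw [AddMonoidHom.mem_ker, hpl, AddMonoidHom.mem_ker.1 q.2, map_zero]⟩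
      one_smul := fun q => Subtype.ext (funext fun j => by
        change φ 1 * q.1 j = _; simp)
      mul_smul := fun b b' q => Subtype.ext (funext fun j => by
        change φ (b * b') * q.1 j = φ b * (φ b' * q.1 j); simp [mul_assoc])
      smul_zero := fun b => Subtype.ext (funext fun j => mul_zero _)
      smul_add := fun b q q' => Subtype.ext (funext fun j => mul_add _ _ _)
      add_smul := fun b b' q => Subtype.ext (funext fun j => by
        change φ (b + b') * q.1 j = φ b * q.1 j + φ b' * q.1 j; simp [add_mul])
      zero_smul := fun q => Subtype.ext (funext fun j => by
        change φ 0 * q.1 j = 0; simp) }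
  let modA : Module Aᵐᵒᵖ p.ker :=
    { smul := fun a q => ⟨fun j => q.1 j * a.unop, by
        rw [AddMonoidHom.mem_ker, hpr, AddMonoidHom.mem_ker.1 q.2, map_zero]⟩
      one_smul := fun q => Subtype.ext (funext fun j => mul_one _)
      mul_smul := fun a a' q => Subtype.ext (funext fun j => (mul_assoc _ _ _).symm)
      smul_zero := fun a => Subtype.ext (funext fun j => zero_mul _)
      smul_add := fun a q q' => Subtype.ext (funext fun j => add_mul _ _ _)
      add_smul := fun a a' q => Subtype.ext (funext fun j => mul_add _ _ _)
      zero_smul := fun q => Subtype.ext (funext fun j => mul_zero _) }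
  have comm : SMulCommClass B Aᵐᵒᵖ p.ker :=
    ⟨fun b a q => Subtype.ext (funext fun j => (mul_assoc _ _ _).symm)⟩
  let e : (TensorSquare φ × p.ker) ≃+ (Fin n → A) :=
    { toFun := fun s => (fun j => α j s.1) + s.2.1
      invFun := fun x => (p x, ⟨x - fun j => α j (p x), by
        rw [AddMonoidHom.mem_ker, map_sub, hpα, sub_self]⟩)
      left_inv := by
        rintro ⟨t, q, hq⟩
        have : p ((fun j => α j t) + q) = t := by
          rw [map_add, hpα, AddMonoidHom.mem_ker.1 hq, add_zero]
        refine Prod.ext this (Subtype.ext ?_)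
        change (fun j => α j t) + q - (fun j => α j (p ((fun j => α j t) + q))) = q
        rw [this, add_sub_cancel_left]
      right_inv := fun x => add_sub_cancel _ _
      map_add' := fun s t => by
        funext j
        simp only [Prod.fst_add, Prod.snd_add, map_add, AddSubgroup.coe_add, Pi.add_apply]
        abel }
  refine ⟨n, p.ker, inferInstance, modB, modA, comm, e, fun b t q j => ?_, fun a t q j => ?_⟩
  · change α j _ + φ b * q.1 j = φ b * (α j t + q.1 j)
    rw [hl, mul_add]
  · change α j _ + q.1 j * a = (α j t + q.1 j) * a
    rw [hr, add_mul]

/-! ### Balance of `E` over `A^op`. -/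

variable (φ) in
theorem isLeftBalanced_rhoHom : IsLeftBalanced (A := leftEnd φ) (B := Aᵐᵒᵖ) (rhoHom φ) := by
  constructor
  · intro a a' h
    have h1 := congrArg (fun f : leftEnd φ => f.1 1) (LinearMap.congr_fun h 1)
    change 1 * a.unop = 1 * a'.unop at h1
    rw [one_mul, one_mul] at h1
    exact MulOpposite.unop_injective h1
  · intro G
    let R (g : leftEnd φ) : leftEnd (A := leftEnd φ) (B := Aᵐᵒᵖ) (rhoHom φ) :=
      ⟨LinearMap.mulRight K g, fun a f => mul_assoc (rhoHom φ a) f g⟩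
    let S (x : A) : leftEnd (A := leftEnd φ) (B := Aᵐᵒᵖ) (rhoHom φ) :=
      ⟨{ toFun := fun f => rhoHom φ (MulOpposite.op (f.1 x))
         map_add' := fun f g => by ext y; simp [rhoHom, mul_add]
         map_smul' := fun k f => by ext y; simp [rhoHom] }, fun a f => by
        ext y; simp [rhoHom, mul_assoc]⟩
    -- Commuting with right multiplications makes `G` left multiplication by `G 1`.
    have hR (f : leftEnd φ) : G f = G 1 * f := by
      have := G.map_smul (R f) 1
      change G (1 * f) = G 1 * f at this
      rwa [one_mul] at this
    -- `S 1` is `f ↦ ρ (f 1)` and fixes `1`, so `G 1 = ρ ((G 1) 1)`.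
    have hS (y : A) : (G 1).1 y = y * (G 1).1 1 := by
      have := G.map_smul (S 1) 1
      change G (rhoHom φ (MulOpposite.op 1)) = rhoHom φ (MulOpposite.op ((G 1).1 1)) at this
      rw [MulOpposite.op_one, map_one] at this
      conv_lhs => rw [this]
      rfl
    refine ⟨MulOpposite.op ((G 1).1 1), ?_⟩
    ext f y
    rw [hR f]
    exact (hS (f.1 y)).symm

/-! ### Pairing endomorphisms with the tensor square. -/

/-- The map `x ⊗ y ↦ x f(y)` on `A ⊗_B A`, for a left `B`-linear `f`. -/
def contract : leftEnd φ →ₗ[K] TensorSquare φ →ₗ[K] A where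
  toFun f := lift φ ((LinearMap.mul K A).compl₂ f.1) fun a b a' => by
    simp [f.2 b a', mul_assoc]
  map_add' f g := by
    refine LinearMap.ext fun t => ?_
    induction t using induction_on with
    | tmul a a' => simp [mul_add]
    | add s t hs ht => simp only [map_add, hs, ht]
  map_smul' k f := by
    refine LinearMap.ext fun t => ?_
    induction t using induction_on with
    | tmul a a' => simp
    | add s t hs ht => simp only [map_add, hs, ht]

@[simp]
theorem contract_tmul (f : leftEnd φ) (x y : A) : contract f (tmul φ x y) = x * f.1 y := rfl

theorem contract_leftMul (f : leftEnd φ) (c : A) (t : TensorSquare φ) :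
    contract f (leftMul φ c t) = c * contract f t := by
  induction t using induction_on with
  | tmul a a' => simp [leftMul_tmul, mul_assoc]
  | add s t hs ht => simp only [map_add, hs, ht, mul_add]

theorem contract_rhoHom_mul (f : leftEnd φ) (a : Aᵐᵒᵖ) (t : TensorSquare φ) :
    contract (rhoHom φ a * f) t = contract f t * a.unop := by
  induction t using induction_on with
  | tmul x y => simp [rhoHom, mul_assoc]
  | add s t hs ht => simp only [map_add, hs, ht, add_mul]

theorem contract_mul_rhoHom (f : leftEnd φ) (a : Aᵐᵒᵖ) (t : TensorSquare φ) :
    contract (f * rhoHom φ a) t = contract f (rightMul φ a.unop t) := by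
  induction t using induction_on with
  | tmul x y => simp [rhoHom, rightMul_tmul]
  | add s t hs ht => simp only [map_add, hs, ht]

/-- The endomorphism `f ↦ (y ↦ u¹ f(u² y))` of `End _B A` given by a `B`-central element `u`
of `A ⊗_B A`. -/
def twist (u : TensorSquare φ) (hu : ∀ b, leftMul φ (φ b) u = rightMul φ (φ b) u) :
    leftEnd φ →ₗ[K] leftEnd φ where
  toFun f := ⟨{ toFun := fun y => contract f (rightMul φ y u)
                map_add' := fun y z => by rw [rightMul_add, map_add]
                map_smul' := fun k y => by rw [rightMul_smul, map_smul, RingHom.id_apply] },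
    fun b y => by
      change contract f (rightMul φ (φ b * y) u) = φ b * contract f (rightMul φ y u)
      rw [rightMul_mul, ← hu, ← leftMul_rightMul, contract_leftMul]⟩
  map_add' f g := by ext y; simp
  map_smul' k f := by ext y; simp

theorem twist_apply (u : TensorSquare φ) (hu : ∀ b, leftMul φ (φ b) u = rightMul φ (φ b) u)
    (f : leftEnd φ) (y : A) : (twist u hu f).1 y = contract f (rightMul φ y u) := rfl

theorem twist_rhoHom_mul (u : TensorSquare φ)
    (hu : ∀ b, leftMul φ (φ b) u = rightMul φ (φ b) u) (a : Aᵐᵒᵖ) (f : leftEnd φ) :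
    twist u hu (rhoHom φ a * f) = rhoHom φ a * twist u hu f := by
  ext y
  exact contract_rhoHom_mul f a _

theorem twist_mul_rhoHom (u : TensorSquare φ)
    (hu : ∀ b, leftMul φ (φ b) u = rightMul φ (φ b) u) (a : Aᵐᵒᵖ) (f : leftEnd φ) :
    twist u hu (f * rhoHom φ a) = twist u hu f * rhoHom φ a := by
  ext y
  change contract (f * rhoHom φ a) (rightMul φ y u) = contract f (rightMul φ (y * a.unop) u)
  rw [contract_mul_rhoHom, rightMul_mul]

/-- The homomorphism `ρ`, with values in an algebra `E` identified with `End _B A`. -/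
def rhoVia {E : Type*} [Ring E] [Algebra K E] (e : E ≃ₐ[K] leftEnd φ) : Aᵐᵒᵖ →ₐ[K] E :=
  e.symm.toAlgHom.comp (rhoHom φ)

/-! ### The tensor square of `E` over `A^op`, seen through evaluations. -/

section Via

variable {E : Type*} [Ring E] [Algebra K E] (e : E ≃ₐ[K] leftEnd φ)

theorem apply_rhoVia (a : Aᵐᵒᵖ) : e (rhoVia e a) = rhoHom φ a :=
  e.apply_symm_apply _

theorem apply_rhoVia_apply (a : Aᵐᵒᵖ) (x : A) : (e (rhoVia e a)).1 x = x * a.unop := by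
  rw [apply_rhoVia]
  rfl

/-- The map `f ⊗ g ↦ f(x g(y))` on `E ⊗_{A^op} E`, where `E = End _B A`. -/
def evalAt (x y : A) : TensorSquare (rhoVia e) →ₗ[K] A :=
  lift (rhoVia e) (LinearMap.mk₂ K (fun f g => (e f).1 (x * (e g).1 y))
    (fun f f' g => by simp) (fun k f g => by simp) (fun f g g' => by simp [mul_add])
    (fun k f g => by simp)) fun f a g => by
      simp [apply_rhoVia, rhoHom, mul_assoc]

theorem evalAt_tmul (x y : A) (f g : E) :
    evalAt e x y (tmul (rhoVia e) f g) = (e f).1 (x * (e g).1 y) := rfl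

theorem evalAt_leftMul (x y : A) (h : E) (t : TensorSquare (rhoVia e)) :
    evalAt e x y (leftMul (rhoVia e) h t) = (e h).1 (evalAt e x y t) := by
  induction t using induction_on with
  | tmul f g =>
    rw [leftMul_tmul, evalAt_tmul, map_mul e]
    rfl
  | add s t hs ht => simp only [map_add, hs, ht]

theorem evalAt_rightMul (x y : A) (h : E) (t : TensorSquare (rhoVia e)) :
    evalAt e x y (rightMul (rhoVia e) h t) = evalAt e x ((e h).1 y) t := by
  induction t using induction_on with
  | tmul f g =>
    rw [rightMul_tmul, evalAt_tmul, map_mul e]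
    rfl
  | add s t hs ht => simp only [map_add, hs, ht]

/-- The map `f ⊗ g ↦ f ∘ ρ(w¹ g(w²))` on `E ⊗_{A^op} E`, where `E = End _B A`. -/
def contractRho (w : TensorSquare φ) : TensorSquare (rhoVia e) →ₗ[K] E :=
  lift (rhoVia e) (LinearMap.mk₂ K
    (fun f g => f * rhoVia e (MulOpposite.op (contract (e g) w)))
    (fun f f' g => by rw [add_mul]) (fun k f g => by rw [smul_mul_assoc])
    (fun f g g' => by simp [mul_add]) (fun k f g => by simp)) fun f a g => by
      simp [apply_rhoVia, contract_rhoHom_mul, mul_assoc]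

theorem contractRho_tmul (w : TensorSquare φ) (f g : E) :
    contractRho e w (tmul (rhoVia e) f g) =
      f * rhoVia e (MulOpposite.op (contract (e g) w)) := rfl

theorem apply_contractRho_tmul (a a' x : A) (t : TensorSquare (rhoVia e)) :
    (e (contractRho e (tmul φ a a') t)).1 x = evalAt e (x * a) a' t := by
  induction t using induction_on with
  | tmul f g => simp [contractRho_tmul, evalAt_tmul, apply_rhoVia_apply, mul_assoc]
  | add s t hs ht =>
    rw [map_add, map_add, map_add, ← hs, ← ht]
    rfl

theorem contractRho_add (w w' : TensorSquare φ) (t : TensorSquare (rhoVia e)) :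
    contractRho e (w + w') t = contractRho e w t + contractRho e w' t := by
  induction t using induction_on with
  | tmul f g => simp [contractRho_tmul, mul_add]
  | add s t hs ht =>
    rw [map_add, map_add, map_add, hs, ht]
    abel

theorem contractRho_eq_zero {t : TensorSquare (rhoVia e)} (ht : ∀ x y, evalAt e x y t = 0)
    (w : TensorSquare φ) : contractRho e w t = 0 := by
  induction w using induction_on with
  | tmul a a' =>
    apply e.injective
    ext x
    rw [apply_contractRho_tmul, ht, map_zero]
    rfl
  | add w w' hw hw' => rw [contractRho_add, hw, hw', add_zero]

variable {n : ℕ} {γ : Fin n → leftEnd φ} {u : Fin n → TensorSquare φ}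

/-- A dual basis for `E` as a left `A^op`-module: pair `f` with the quasibasis identity. -/
theorem sum_rhoHom_contract_mul (h : ∀ y, ∑ j, leftMul φ ((γ j).1 y) (u j) = tmul φ 1 y)
    (f : leftEnd φ) : ∑ j, rhoHom φ (MulOpposite.op (contract f (u j))) * γ j = f := by
  ext y
  have := congrArg (contract f) (h y)
  rw [map_sum, contract_tmul, one_mul] at this
  simpa [rhoHom, contract_leftMul, LinearMap.sum_apply] using this

/-- Expand `g` in the dual basis and move its coefficients across `f ⊗ g`; what remains on the left
is determined by evaluations (`contractRho_eq_zero`). -/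
theorem sum_tmul_contractRho (h : ∀ y, ∑ j, leftMul φ ((γ j).1 y) (u j) = tmul φ 1 y)
    (t : TensorSquare (rhoVia e)) :
    ∑ j, tmul (rhoVia e) (contractRho e (u j) t) (e.symm (γ j)) = t := by
  induction t using induction_on with
  | tmul f g =>
    have hg : ∑ j, rhoVia e (MulOpposite.op (contract (e g) (u j))) * e.symm (γ j) = g := by
      apply e.injective
      simpa [apply_rhoVia] using sum_rhoHom_contract_mul h (e g)
    simp only [contractRho_tmul, tmul_balanced]
    simp only [← mk_apply, ← map_sum, hg]
  | add s t hs ht =>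
    simp only [← mk_apply] at hs ht ⊢
    simp only [map_add, LinearMap.add_apply, Finset.sum_add_distrib, hs, ht]

theorem eq_of_evalAt_eq (h : ∀ y, ∑ j, leftMul φ ((γ j).1 y) (u j) = tmul φ 1 y)
    {s t : TensorSquare (rhoVia e)} (hst : ∀ x y, evalAt e x y s = evalAt e x y t) : s = t := by
  rw [← sub_eq_zero, ← sum_tmul_contractRho e h (s - t)]
  refine Finset.sum_eq_zero fun j _ => ?_
  rw [contractRho_eq_zero e (fun x y => by rw [map_sub, hst, sub_self]), ← mk_apply, map_zero,
    LinearMap.zero_apply]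

/-- Every `B`-bilinear `g` has an element of `E ⊗_{A^op} E` representing `x ⊗ y ↦ g(x) y`. -/
theorem exists_evalAt_eq (h : ∀ y, ∑ j, leftMul φ ((γ j).1 y) (u j) = tmul φ 1 y)
    (g : leftEnd φ) (hg : ∀ x b, g.1 (x * φ b) = g.1 x * φ b) :
    ∃ c : TensorSquare (rhoVia e), ∀ x y, evalAt e x y c = g.1 x * y := by
  let C : TensorSquare φ →ₗ[K] A := lift φ ((LinearMap.mul K A).comp g.1) fun a b a' => by
    simp [hg, mul_assoc]
  have hC (b : B) (t : TensorSquare φ) : C (leftMul φ (φ b) t) = φ b * C t := by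
    induction t using induction_on with
    | tmul x y =>
      change g.1 (φ b * x) * y = φ b * (g.1 x * y)
      rw [g.2 b x, mul_assoc]
    | add s t hs ht => simp only [map_add, hs, ht, mul_add]
  let d (k : Fin n) : leftEnd φ :=
    ⟨{ toFun := fun x => C (leftMul φ x (u k))
       map_add' := fun x y => by rw [leftMul_add, map_add]
       map_smul' := fun r x => by rw [leftMul_smul, map_smul, RingHom.id_apply] }, fun b x => by
      change C (leftMul φ (φ b * x) (u k)) = φ b * C (leftMul φ x (u k))
      rw [leftMul_mul, hC]⟩
  -- Chosen since `∑ C(x γ k(y) · u k) = C(x ⊗ y)` by the quasibasis identity.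
  refine ⟨∑ k, tmul (rhoVia e) (e.symm (d k)) (e.symm (γ k)), fun x y => ?_⟩
  simp only [map_sum, evalAt_tmul, AlgEquiv.apply_symm_apply]
  change ∑ k, C (leftMul φ (x * (γ k).1 y) (u k)) = g.1 x * y
  simp only [leftMul_mul, ← map_sum, h, leftMul_tmul, mul_one]
  rfl

theorem IsRightDepthTwo.isLeftDepthTwo_of_algEquiv (h : IsRightDepthTwo φ)
    (ψ : Aᵐᵒᵖ →ₐ[K] E) (hψ : ∀ a, e (ψ a) = rhoHom φ a) : IsLeftDepthTwo ψ := by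
  obtain rfl : ψ = rhoVia e := AlgHom.ext fun a => e.injective (by rw [hψ, apply_rhoVia])
  obtain ⟨n, γ, u, hγ, hu, h⟩ := h.exists_quasibasis
  choose c hc using fun j => exists_evalAt_eq e h (γ j) (hγ j)
  refine isLeftDepthTwo_of_quasibasis
    (fun j => e.symm.toLinearMap ∘ₗ twist (u j) (hu j) ∘ₗ e.toLinearMap) c
    (fun j a f => e.injective ?_) (fun j f a => e.injective ?_) (fun j a => ?_) fun f => ?_
  · simp [apply_rhoVia, twist_rhoHom_mul]
  · simp [apply_rhoVia, twist_mul_rhoHom]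
  -- Centrality of `c j`: both sides evaluate to `γ j x * y * a`.
  · refine eq_of_evalAt_eq e h fun x y => ?_
    rw [evalAt_leftMul, evalAt_rightMul, hc, hc, apply_rhoVia_apply, apply_rhoVia_apply, mul_assoc]
  · refine eq_of_evalAt_eq e h fun x y => ?_
    simp only [map_sum, evalAt_rightMul, hc, evalAt_tmul, LinearMap.comp_apply,
      AlgEquiv.toLinearMap_apply, AlgEquiv.apply_symm_apply, twist_apply, ← contract_leftMul,
      leftMul_rightMul]
    rw [← map_sum, ← map_sum, h, rightMul_tmul, contract_tmul, one_mul, map_one]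
    rfl

end Via

theorem IsRightDepthTwo.isLeftDepthTwo_rhoHom (h : IsRightDepthTwo φ) :
    IsLeftDepthTwo (A := leftEnd φ) (B := Aᵐᵒᵖ) (rhoHom φ) := by
  have := IsRightDepthTwo.isLeftDepthTwo_of_algEquiv (E := leftEnd φ) AlgEquiv.refl h (rhoHom φ)
    (fun a => congrFun AlgEquiv.coe_refl (rhoHom φ a))
  exact this

end EndomorphismRing

theorem corollary2p3 {K : Type*} [CommRing K] {A : Type*} [Ring A] [Algebra K A]
    {B : Type*} [Ring B] [Algebra K B] (φ : B →ₐ[K] A) (h : IsDepthTwo φ) :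
    IsLeftDepthTwo (A := leftEnd φ) (B := Aᵐᵒᵖ) (rhoHom φ) ∧
      IsLeftBalanced (A := leftEnd φ) (B := Aᵐᵒᵖ) (rhoHom φ) :=
  ⟨h.2.isLeftDepthTwo_rhoHom, isLeftBalanced_rhoHom φ⟩
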